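/- Let $R$ be a commutative local ring, let $\mathcal{A}$ be a finite $R$-Hopf algebra (that is, finitely generated projective as an $R$-module) with comultiplication $a\mapsto\sum a_{(1)}\otimes a_{(2)}$ and counit $\varepsilon$, and let $S$ be a finite (finitely generated projective as an $R$-module), not necessarily commutative, $R$-algebra which is a left $\mathcal{A}$-module algebra, i.e. $a(st)=\sum (a_{(1)}s)(a_{(2)}t)$ and $a1=\varepsilon(a)1$. Assume that $S$ is a faithful $\mathcal{A}$-module (if $as=0$ for all $s\in S$, then $a=0$), that $\operatorname{rank}_R S=\operatorname{rank}_R\mathcal{A}$, and that $S^{\mathcal{A}}=R$, where $M^{\mathcal{A}}=\{m\in M: am=\varepsilon(a)m \text{ for all } a\in\mathcal{A}\}$ for a left $\mathcal{A}$-module $M$. Let $I=\mathcal{A}^{\mathcal{A}}$ be the module of left integrals of $\mathcal{A}$. In general, $S$ is called a tame $\mathcal{A}$-extension of $R$ if $S$ is a finite $R$-algebra and a left $\mathcal{A}$-module algebra with $S^{\mathcal{A}}=R$, it is faithful as an $\mathcal{A}$-module, $\operatorname{rank}_R S=\operatorname{rank}_R\mathcal{A}$, and $IS=R$, where $IS$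 is the $R$-submodule of $S$ generated by the elements $\lambda s$ with $\lambda\in I$, $s\in S$. Let $\mathcal{A}^*=\operatorname{Hom}_R(\mathcal{A},R)$ be the dual Hopf algebra, with product $(fg)(a)=\sum f(a_{(1)})g(a_{(2)})$, unit $1=\varepsilon$, counit $f\mapsto f(1)$ and coproduct determined by $\sum f_{(1)}(a)f_{(2)}(b)=f(ab)$; it is a left $\mathcal{A}$-module by $(af)(b)=f(ba)$. Then $S$ is a tame $\mathcal{A}$-extension of $R$ if and only if there exists a left $\mathcal{A}$-module homomorphism $g:\mathcal{A}^*\to S$ with $g(1)=1$. In particular, suppose that $R$ is a field and $S$ is a tame $\mathcal{A}$-extension of $R$. Regard $S$ as a right $\mathcal{A}^*$-comodule via the coaction $s\mapsto\sum s_{(0)}\otimes s_{(1)}$ determined by $as=\sum s_{(1)}(a)s_{(0)}$ for all $a\in\mathcal{A}$. Then every relative $(S,\mathcal{A}^*)$-Hopf module is injective as a right $\mathcal{A}^*$-comodule. Here a relative $(S,\mathcal{A}^*)$-Hopf module is a right $\mathcal{A}^*$-comodule $(M,\rho)$ which is either a right $S$-module with $\rho(ms)=\rho(m)\rho(s)$,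 i.e. $\rho(ms)=\sum m_{(0)}s_{(0)}\otimes m_{(1)}s_{(1)}$, or a left $S$-module with $\rho(sm)=\sum s_{(0)}m_{(0)}\otimes s_{(1)}m_{(1)}$; the assertion holds for both kinds. -/

import Mathlib

open scoped TensorProduct

universe u v w x y

noncomputable section

namespace TameHopf

section Invariants

variable (R : Type u) (A : Type v) [CommRing R] [Ring A] [HopfAlgebra R A]

/-- The fixed points `M^A = {m | a m = ε(a) m for all a ∈ A}` of a left `A`-module `M`. -/
def invariants (M : Type w) [AddCommGroup M] [Module R M] [Module A M] [IsScalarTower R A M] :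
    Submodule R M where
  carrier := {m | ∀ a : A, a • m = (Coalgebra.counit (R := R) a) • m}
  add_mem' := by
    intro m n hm hn a
    rw [smul_add, smul_add, hm a, hn a]
  zero_mem' := by
    intro a
    simp
  smul_mem' := by
    intro r m hm a
    rw [smul_comm a r m, hm a, smul_comm]

/-- The module of left integrals `I = A^A = {t | a t = ε(a) t for all a ∈ A}`. -/
def leftIntegrals : Submodule R A := invariants R A A

variable (S : Type w) [Ring S] [Algebra R S] [Module A S] [IsScalarTower R A S]

/-- `S` is a left `A`-module algebra:
`a (s t) = ∑ (a₍₁₎ s) (a₍₂₎ t)` and `a 1 = ε(a) 1`. -/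
structure IsModuleAlgebra : Prop where
  smul_mul : ∀ (a : A) (s t : S),
    a • (s * t) = LinearMap.mul' R S
      (TensorProduct.map ((LinearMap.toSpanSingleton A S s).restrictScalars R)
        ((LinearMap.toSpanSingleton A S t).restrictScalars R) (Coalgebra.comul a))
  smul_one : ∀ a : A, a • (1 : S) = algebraMap R S (Coalgebra.counit a)

/-- `S^A = R`: the structure map `R → S` is injective with image `S^A`. -/
def FixedPointsEqBase : Prop :=
  Function.Injective (algebraMap R S) ∧
    invariants R A S = LinearMap.range (Algebra.linearMap R S)

/-- `S` is an `A`-extension of `R`: a finite (finitely generated projective) `R`-algebra which is a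
left `A`-module algebra with `S^A = R`. -/
structure IsExtension : Prop where
  finite : Module.Finite R S
  projective : Module.Projective R S
  moduleAlgebra : IsModuleAlgebra R A S
  fixedPoints : FixedPointsEqBase R A S

/-- `I S`, the `R`-submodule of `S` generated by all `t s` with `t` a left integral, `s ∈ S`. -/
def integralImage : Submodule R S :=
  Submodule.span R {z | ∃ t ∈ leftIntegrals R A, ∃ s : S, z = t • s}

/-- `S` is a tame `A`-extension of `R` (over a local ring `R`, where finitely generated projective
modules are free, so that the rank is `Module.finrank`). -/
structure IsTameExtension : Prop extends IsExtension R A S where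
  rank_eq : Module.finrank R S = Module.finrank R A
  faithful : ∀ a : A, (∀ s : S, a • s = 0) → a = 0
  integralImage_eq : integralImage R A S = LinearMap.range (Algebra.linearMap R S)

end Invariants

section Dual

variable (R : Type u) (A : Type v) [CommRing R] [Ring A] [HopfAlgebra R A]

/-- The dual `A* = Hom_R(A, R)`. The synonym `WithConv` carries the convolution product
`(f g)(a) = ∑ f(a₍₁₎) g(a₍₂₎)`, whose unit is the counit `ε` of `A`. -/
abbrev HopfDual : Type (max u v) := WithConv (A →ₗ[R] R)

/-- The left `A`-module structure `(a f)(b) = f(b a)` on `A*`. -/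
instance HopfDual.instModule : Module A (HopfDual R A) where
  smul a f := WithConv.toConv (f.ofConv ∘ₗ LinearMap.mulRight R a)
  one_smul f := WithConv.ext (LinearMap.ext fun b => congrArg f.ofConv (mul_one b))
  mul_smul a a' f := WithConv.ext (LinearMap.ext fun b =>
    congrArg f.ofConv (mul_assoc b a a').symm)
  smul_zero _ := rfl
  smul_add _ _ _ := rfl
  add_smul a a' f := WithConv.ext (LinearMap.ext fun b =>
    (congrArg f.ofConv (mul_add b a a')).trans (map_add f.ofConv _ _))
  zero_smul f := WithConv.ext (LinearMap.ext fun b =>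
    (congrArg f.ofConv (mul_zero b)).trans (map_zero f.ofConv))

theorem HopfDual.smul_apply (a b : A) (f : HopfDual R A) :
    (a • f).ofConv b = f.ofConv (b * a) := rfl

instance HopfDual.instIsScalarTower : IsScalarTower R A (HopfDual R A) where
  smul_assoc r a f := WithConv.ext (LinearMap.ext fun b => by
    change f.ofConv (b * (r • a)) = r • f.ofConv (b * a)
    rw [mul_smul_comm, map_smul])

/-- Evaluation at `a`, as a linear form on `A*`. -/
def evalAt (a : A) : HopfDual R A →ₗ[R] R :=
  LinearMap.applyₗ a ∘ₗ (WithConv.linearEquiv R (A →ₗ[R] R)).toLinearMap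

@[simp] theorem evalAt_apply (a : A) (f : HopfDual R A) : evalAt R A a f = f.ofConv a := rfl

variable [Module.Finite R A] [Module.Projective R A]

section Coaction

variable (M : Type w) [AddCommGroup M] [Module R M]

/-- For `A` finite, the isomorphism `M ⊗ A* ≃ Hom_R(A, M)`, `m ⊗ f ↦ (a ↦ f(a) m)`. -/
def tensorDualEquiv : M ⊗[R] HopfDual R A ≃ₗ[R] (A →ₗ[R] M) :=
  TensorProduct.congr (LinearEquiv.refl R M) (WithConv.linearEquiv R (A →ₗ[R] R)) ≪≫ₗ
    TensorProduct.comm R M (A →ₗ[R] R) ≪≫ₗ dualTensorHomEquiv R A M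

theorem tensorDualEquiv_tmul (m : M) (f : HopfDual R A) (a : A) :
    tensorDualEquiv R A M (m ⊗ₜ f) a = f.ofConv a • m := rfl

variable [Module A M] [IsScalarTower R A M]

/-- The map `M → Hom_R(A, M)`, `m ↦ (a ↦ a m)`. -/
def actionMap : M →ₗ[R] A →ₗ[R] M :=
  LinearMap.mk₂ R (fun m a => a • m) (fun m n a => smul_add a m n)
    (fun r m a => smul_comm a r m) (fun m a b => add_smul a b m) (fun r m a => smul_assoc r a m)

/-- The right `A*`-coaction `m ↦ ∑ m₍₀₎ ⊗ m₍₁₎` on a left `A`-module `M`, determined by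
`a m = ∑ m₍₁₎(a) m₍₀₎` for all `a ∈ A`. -/
def inducedCoaction : M →ₗ[R] M ⊗[R] HopfDual R A :=
  (tensorDualEquiv R A M).symm.toLinearMap ∘ₗ actionMap R A M

theorem tensorDualEquiv_inducedCoaction (m : M) (a : A) :
    tensorDualEquiv R A M (inducedCoaction R A M m) a = a • m := by
  simp only [inducedCoaction, LinearMap.comp_apply, LinearEquiv.coe_coe,
    LinearEquiv.apply_symm_apply]
  rfl

end Coaction

/-- The coalgebra operations of `A*`: the counit is `f ↦ f(1)` and the comultiplication
`f ↦ ∑ f₍₁₎ ⊗ f₍₂₎` is dual to the product of `A`, `∑ f₍₁₎(a) f₍₂₎(b) = f(a b)`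
(see `HopfDual.comul_spec`). -/
instance HopfDual.instCoalgebraStruct : CoalgebraStruct R (HopfDual R A) where
  comul := inducedCoaction R A (HopfDual R A)
  counit := evalAt R A 1

theorem HopfDual.comul_spec (f : HopfDual R A) (a b : A) :
    LinearMap.mul' R R (TensorProduct.map (evalAt R A a) (evalAt R A b)
      (CoalgebraStruct.comul (R := R) f)) = f.ofConv (a * b) := by
  have key : ∀ z : HopfDual R A ⊗[R] HopfDual R A,
      LinearMap.mul' R R (TensorProduct.map (evalAt R A a) (evalAt R A b) z) =
        (tensorDualEquiv R A (HopfDual R A) z b).ofConv a := by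
    intro z
    induction z with
    | zero => simp
    | add z z' hz hz' => simp [hz, hz']
    | tmul g h => simp [tensorDualEquiv_tmul, mul_comm]
  rw [key]
  change (tensorDualEquiv R A _ (inducedCoaction R A _ f) b).ofConv a = _
  rw [tensorDualEquiv_inducedCoaction, HopfDual.smul_apply]

section Comodule

variable (M : Type w) [AddCommGroup M] [Module R M] [Module A M] [IsScalarTower R A M]

theorem inducedCoaction_coassoc (m : M) :
    TensorProduct.assoc R M (HopfDual R A) (HopfDual R A)
        ((inducedCoaction R A M).rTensor (HopfDual R A) (inducedCoaction R A M m)) =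
      (CoalgebraStruct.comul (R := R) (A := HopfDual R A)).lTensor M
        (inducedCoaction R A M m) := by
  apply (TensorProduct.assoc R M (HopfDual R A) (HopfDual R A)).symm.injective
  apply (tensorDualEquiv R A (M ⊗[R] HopfDual R A)).injective
  ext a
  apply (tensorDualEquiv R A M).injective
  ext b
  have h1 : ∀ z : M ⊗[R] HopfDual R A,
      tensorDualEquiv R A (M ⊗[R] HopfDual R A)
        ((inducedCoaction R A M).rTensor (HopfDual R A) z) a =
      inducedCoaction R A M (tensorDualEquiv R A M z a) := by
    intro z
    induction z with
    | zero => simp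
    | add z z' hz hz' => simp [hz, hz']
    | tmul n f => simp [tensorDualEquiv_tmul]
  have h3 : ∀ (n : M) (t : HopfDual R A ⊗[R] HopfDual R A),
      tensorDualEquiv R A (M ⊗[R] HopfDual R A)
        ((TensorProduct.assoc R M (HopfDual R A) (HopfDual R A)).symm (n ⊗ₜ t)) a =
      n ⊗ₜ[R] (tensorDualEquiv R A (HopfDual R A) t a) := by
    intro n t
    induction t with
    | zero => simp
    | add z z' hz hz' => simp [TensorProduct.tmul_add, hz, hz']
    | tmul f g => simp [tensorDualEquiv_tmul]
  have h2 : ∀ z : M ⊗[R] HopfDual R A,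
      tensorDualEquiv R A M (tensorDualEquiv R A (M ⊗[R] HopfDual R A)
        ((TensorProduct.assoc R M (HopfDual R A) (HopfDual R A)).symm
          ((CoalgebraStruct.comul (R := R) (A := HopfDual R A)).lTensor M z)) a) b =
      tensorDualEquiv R A M z (b * a) := by
    intro z
    induction z with
    | zero => simp
    | add z z' hz hz' => simp [hz, hz']
    | tmul n f =>
      rw [LinearMap.lTensor_tmul, h3]
      change tensorDualEquiv R A M
        (n ⊗ₜ tensorDualEquiv R A _ (inducedCoaction R A _ f) a) b = _
      rw [tensorDualEquiv_inducedCoaction, tensorDualEquiv_tmul, tensorDualEquiv_tmul,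
        HopfDual.smul_apply]
  rw [LinearEquiv.symm_apply_apply, h1, h2, tensorDualEquiv_inducedCoaction,
    tensorDualEquiv_inducedCoaction, tensorDualEquiv_inducedCoaction, mul_smul]

theorem inducedCoaction_counit (m : M) :
    (CoalgebraStruct.counit (R := R) (A := HopfDual R A)).lTensor M
      (inducedCoaction R A M m) = m ⊗ₜ[R] (1 : R) := by
  have h : ∀ z : M ⊗[R] HopfDual R A,
      (CoalgebraStruct.counit (R := R) (A := HopfDual R A)).lTensor M z =
        (tensorDualEquiv R A M z 1) ⊗ₜ[R] (1 : R) := by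
    intro z
    induction z with
    | zero => simp
    | add z z' hz hz' => simp [hz, hz', TensorProduct.add_tmul]
    | tmul n f =>
      rw [LinearMap.lTensor_tmul, tensorDualEquiv_tmul, TensorProduct.smul_tmul, smul_eq_mul,
        mul_one]
      rfl
  rw [h, tensorDualEquiv_inducedCoaction, one_smul]

end Comodule

instance HopfDual.instCoalgebra : Coalgebra R (HopfDual R A) where
  coassoc := LinearMap.ext fun f => inducedCoaction_coassoc R A (HopfDual R A) f
  rTensor_counit_comp_comul := by
    have h : ∀ z : HopfDual R A ⊗[R] HopfDual R A, ∀ a : A,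
        tensorDualEquiv R A R
          ((CoalgebraStruct.counit (R := R) (A := HopfDual R A)).rTensor (HopfDual R A) z) a =
          (tensorDualEquiv R A (HopfDual R A) z a).ofConv 1 := by
      intro z a
      induction z with
      | zero => simp
      | add z z' hz hz' => simp [hz, hz']
      | tmul f g => rfl
    refine LinearMap.ext fun f => (tensorDualEquiv R A R).injective (LinearMap.ext fun a => ?_)
    refine (h _ a).trans ?_
    change (tensorDualEquiv R A _ (inducedCoaction R A _ f) a).ofConv 1 = f.ofConv a • (1 : R)
    rw [tensorDualEquiv_inducedCoaction, HopfDual.smul_apply, one_mul, smul_eq_mul, mul_one]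
  lTensor_counit_comp_comul := LinearMap.ext fun f =>
    inducedCoaction_counit R A (HopfDual R A) f

end Dual

section Comodules

/-- `ρ` makes `M` a right comodule over the coalgebra `C`. -/
structure IsRightComodule {R : Type u} {C : Type v} {M : Type w} [CommRing R]
    [AddCommGroup C] [Module R C] [Coalgebra R C] [AddCommGroup M] [Module R M]
    (ρ : M →ₗ[R] M ⊗[R] C) : Prop where
  coassoc : ∀ m : M, TensorProduct.assoc R M C C (ρ.rTensor C (ρ m)) =
    (Coalgebra.comul (R := R) (A := C)).lTensor M (ρ m)
  counit : ∀ m : M, (Coalgebra.counit (R := R) (A := C)).lTensor M (ρ m) = m ⊗ₜ[R] (1 : R)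

/-- The coaction induced by a left `A`-module structure is a right `A*`-comodule structure. -/
theorem isRightComodule_inducedCoaction (R : Type u) (A : Type v) [CommRing R] [Ring A]
    [HopfAlgebra R A] [Module.Finite R A] [Module.Projective R A]
    (M : Type w) [AddCommGroup M] [Module R M] [Module A M] [IsScalarTower R A M] :
    IsRightComodule (inducedCoaction R A M) :=
  ⟨inducedCoaction_coassoc R A M, inducedCoaction_counit R A M⟩

/-- `f` is a morphism of right `C`-comodules `(X, ρX) → (Y, ρY)`. -/
def IsComoduleHom {R : Type u} {C : Type v} {X : Type w} {Y : Type x} [CommRing R]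
    [AddCommGroup C] [Module R C] [AddCommGroup X] [Module R X] [AddCommGroup Y] [Module R Y]
    (ρX : X →ₗ[R] X ⊗[R] C) (ρY : Y →ₗ[R] Y ⊗[R] C) (f : X →ₗ[R] Y) : Prop :=
  ∀ a : X, ρY (f a) = f.rTensor C (ρX a)

/-- `(M, ρ)` is an injective right comodule: every comodule morphism `f : X → M` extends along
every injective comodule morphism `i : X → Y`. Here `X`, `Y` range over comodules in an arbitrary
universe `y`. (Over a field the injective comodule morphisms are exactly the monomorphisms of
comodules.) -/
def IsInjectiveComodule {R : Type u} {C : Type v} {M : Type x} [CommRing R]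
    [AddCommGroup C] [Module R C] [Coalgebra R C] [AddCommGroup M] [Module R M]
    (ρ : M →ₗ[R] M ⊗[R] C) : Prop :=
  ∀ (X Y : Type y) [AddCommGroup X] [Module R X] [AddCommGroup Y] [Module R Y]
    (ρX : X →ₗ[R] X ⊗[R] C) (ρY : Y →ₗ[R] Y ⊗[R] C),
    IsRightComodule ρX → IsRightComodule ρY →
    ∀ (i : X →ₗ[R] Y) (f : X →ₗ[R] M),
      IsComoduleHom ρX ρY i → Function.Injective i → IsComoduleHom ρX ρ f →
      ∃ g : Y →ₗ[R] M, IsComoduleHom ρY ρ g ∧ g ∘ₗ i = f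

/-- The action `(m, s) ↦ m s` of a right `S`-module, as a bilinear map. -/
def rightAction (R : Type u) (S : Type w) (M : Type x) [CommRing R] [Ring S] [Algebra R S]
    [AddCommGroup M] [Module R M] [Module Sᵐᵒᵖ M] [IsScalarTower R Sᵐᵒᵖ M] :
    M →ₗ[R] S →ₗ[R] M :=
  LinearMap.mk₂ R (fun m s => MulOpposite.op s • m)
    (fun m n s => smul_add _ m n)
    (fun r m s => smul_comm (MulOpposite.op s) r m)
    (fun m s t => by rw [MulOpposite.op_add, add_smul])
    (fun r m s => by rw [MulOpposite.op_smul, smul_assoc])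

/-- The action `(s, m) ↦ s m` of a left `S`-module, as a bilinear map. -/
def leftAction (R : Type u) (S : Type w) (M : Type x) [CommRing R] [Ring S] [Algebra R S]
    [AddCommGroup M] [Module R M] [Module S M] [IsScalarTower R S M] :
    S →ₗ[R] M →ₗ[R] M :=
  LinearMap.mk₂ R (fun s m => s • m)
    (fun s t m => add_smul s t m)
    (fun r s m => smul_assoc r s m)
    (fun s m n => smul_add s m n)
    (fun r s m => smul_comm s r m)

/-- `(M, ρ)` is a relative `(S, H)`-Hopf module with `M` a right `S`-module, where `S` has the
right `H`-coaction `σ`: `M` is a right `H`-comodule and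
`ρ(m s) = ∑ m₍₀₎ s₍₀₎ ⊗ m₍₁₎ s₍₁₎`. -/
structure IsRightRelativeHopfModule {R : Type u} {H : Type v} {S : Type w} {M : Type x}
    [CommRing R] [Ring H] [Algebra R H] [Coalgebra R H] [Ring S] [Algebra R S]
    [AddCommGroup M] [Module R M] [Module Sᵐᵒᵖ M] [IsScalarTower R Sᵐᵒᵖ M]
    (σ : S →ₗ[R] S ⊗[R] H) (ρ : M →ₗ[R] M ⊗[R] H) : Prop where
  isRightComodule : IsRightComodule ρ
  coaction_smul : ∀ (m : M) (s : S), ρ (MulOpposite.op s • m) =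
    TensorProduct.map₂ (rightAction R S M) (LinearMap.mul R H) (ρ m) (σ s)

/-- `(M, ρ)` is a relative `(S, H)`-Hopf module with `M` a left `S`-module, where `S` has the
right `H`-coaction `σ`: `M` is a right `H`-comodule and
`ρ(s m) = ∑ s₍₀₎ m₍₀₎ ⊗ s₍₁₎ m₍₁₎`. -/
structure IsLeftRelativeHopfModule {R : Type u} {H : Type v} {S : Type w} {M : Type x}
    [CommRing R] [Ring H] [Algebra R H] [Coalgebra R H] [Ring S] [Algebra R S]
    [AddCommGroup M] [Module R M] [Module S M] [IsScalarTower R S M]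
    (σ : S →ₗ[R] S ⊗[R] H) (ρ : M →ₗ[R] M ⊗[R] H) : Prop where
  isRightComodule : IsRightComodule ρ
  coaction_smul : ∀ (m : M) (s : S), ρ (s • m) =
    TensorProduct.map₂ (leftAction R S M) (LinearMap.mul R H) (σ s) (ρ m)

end Comodules

end TameHopf

end

/-! Write χ for the antipode. Everything rests on `exists_frobenius_form`: over a local ring a
finite Hopf algebra has bijective antipode, and `A* = Aθ` is free of rank one. Let `t` be the
element with `tθ = ε`, the unit of `A*`. It is a left integral, and every left integral is a
multiple of it, so `IS = tS`.

Tameness therefore gives `s` with `ts = 1`, and `aθ ↦ as` is the required map `g`. Conversely, `1 =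
g(tθ) = t g(θ)` lies in `IS`, while `IS ⊆ S^A = R` always holds.

Comodules over `A*` are treated as `A`-modules. Over a field, an injective comodule map `i` has a
linear retraction `l`, and `f ∘ l` is made `A`-linear by averaging: `n ↦ ∑ t₍₁₎ h(χ(t₍₂₎) n)` is
`A`-linear for every linear `h`. With `h = s · f(l(-))` the average still extends `f`, because on a
Hopf module `∑ t₍₁₎(s · χ(t₍₂₎)m) = ∑ (t₍₁₎s)(t₍₂₎χ(t₍₃₎)m) = (ts)m = m`. Right `S`-modules need the
mirror image `∑ t₍₂₎ ⊗ χ⁻¹(t₍₁₎)`, hence the bijectivity of χ.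

The Frobenius form comes from a nonzero right integral, obtained from a trace formula: a family of
traces consists of right integrals, and a sum of their coordinates is 1, so locality of `R` makes
one coordinate a unit (`exists_right_integral`). -/

namespace TameHopf

open Coalgebra HopfAlgebra

/-! ### Sweedler identities for the antipode and for integrals -/

section Sweedler

variable {R : Type u} {A : Type v} [CommRing R] [Ring A] [HopfAlgebra R A]

/-- `∑ ε(a₍₂₎) a₍₁₎ = a`. -/
theorem sum_counit_right_smul {ι : Type*} {a : A} (r : Repr R a ι) :
    ∑ i ∈ r.index, counit (R := R) (r.right i) • r.left i = a := by
  have h := congrArg (TensorProduct.rid R A) (sum_tmul_counit_eq r)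
  simpa only [map_sum, TensorProduct.rid_tmul, one_smul] using h

/-- `∑ a₍₁₎ ⊗ ψ(a₍₂₎) φ(a₍₃₎) = a ⊗ 1` if `∑ ψ(a₍₁₎) φ(a₍₂₎) = ε(a)`. -/
theorem sum_lTensor_comul_mul (ψ φ : A →ₗ[R] A)
    (h : ∀ a : A, LinearMap.mul' R A (TensorProduct.map ψ φ (comul a)) =
      algebraMap R A (counit a)) {ι : Type*} {a : A} (r : Repr R a ι) :
    ∑ i ∈ r.index, ψ.lTensor A (comul (R := R) (r.left i)) * ((1 : A) ⊗ₜ[R] φ (r.right i)) =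
      a ⊗ₜ[R] (1 : A) := by
  have key : ∀ (z : A ⊗[R] A) (c : A), ψ.lTensor A z * ((1 : A) ⊗ₜ[R] φ c) =
      (LinearMap.mul' R A ∘ₗ TensorProduct.map ψ φ).lTensor A
        (TensorProduct.assoc R A A A (z ⊗ₜ c)) := by
    intro z c
    induction z with
    | zero => simp
    | add z z' hz hz' => simp only [map_add, add_mul, TensorProduct.add_tmul, hz, hz']
    | tmul p q => simp
  -- Coassociativity regroups the sum as `∑ a₍₁₎ ⊗ ψ(a₍₂₎)φ(a₍₃₎)`, where `h` collapses the second
  -- factor to `ε(a₍₂₎)`.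
  have e := congrArg ((LinearMap.mul' R A ∘ₗ TensorProduct.map ψ φ).lTensor A)
    (coassoc_apply (R := R) a)
  rw [← r.eq] at e
  simp only [map_sum, LinearMap.rTensor_tmul, LinearMap.lTensor_tmul, LinearMap.comp_apply, h]
    at e
  simp only [key, e, Algebra.algebraMap_eq_smul_one, TensorProduct.tmul_smul,
    TensorProduct.smul_tmul', ← TensorProduct.sum_tmul, sum_counit_right_smul]

/-- `∑ ψ(a₍₂₎) φ(a₍₁₎) ⊗ a₍₃₎ = 1 ⊗ a` if `∑ ψ(a₍₂₎) φ(a₍₁₎) = ε(a)`. -/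
theorem sum_rTensor_comul_mul (ψ φ : A →ₗ[R] A)
    (h : ∀ a : A, LinearMap.mul' R A
      (TensorProduct.map ψ φ (TensorProduct.comm R A A (comul a))) =
      algebraMap R A (counit a)) {ι : Type*} {a : A} (r : Repr R a ι) :
    ∑ i ∈ r.index, ψ.rTensor A (comul (R := R) (r.right i)) * (φ (r.left i) ⊗ₜ[R] (1 : A)) =
      (1 : A) ⊗ₜ[R] a := by
  have key : ∀ (z : A ⊗[R] A) (c : A), ψ.rTensor A z * (φ c ⊗ₜ[R] (1 : A)) =
      (LinearMap.mul' R A ∘ₗ TensorProduct.map ψ φ ∘ₗ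
        (TensorProduct.comm R A A).toLinearMap).rTensor A
        ((TensorProduct.assoc R A A A).symm (c ⊗ₜ z)) := by
    intro z c
    induction z with
    | zero => simp
    | add z z' hz hz' => simp only [map_add, add_mul, TensorProduct.tmul_add, hz, hz']
    | tmul p q => simp
  have e := congrArg ((LinearMap.mul' R A ∘ₗ TensorProduct.map ψ φ ∘ₗ
        (TensorProduct.comm R A A).toLinearMap).rTensor A)
    (coassoc_symm_apply (R := R) a)
  rw [← r.eq] at e
  simp only [map_sum, LinearMap.rTensor_tmul, LinearMap.lTensor_tmul, LinearMap.comp_apply,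
    LinearEquiv.coe_coe, h] at e
  simp only [key, e, Algebra.algebraMap_eq_smul_one, TensorProduct.smul_tmul,
    ← TensorProduct.tmul_sum, sum_counit_smul]

theorem mul'_map_id_antipode (a : A) :
    LinearMap.mul' R A (TensorProduct.map .id (antipode R) (comul a)) =
      algebraMap R A (counit a) :=
  mul_antipode_lTensor_comul_apply a

theorem mul'_map_antipode_id (a : A) :
    LinearMap.mul' R A (TensorProduct.map (antipode R) .id (comul a)) =
      algebraMap R A (counit a) :=
  mul_antipode_rTensor_comul_apply a

/-- `∑ S²(a₍₂₎) S(a₍₁₎) = ε(a)`. -/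
theorem mul'_map_antipode_sq_antipode_comm (a : A) :
    LinearMap.mul' R A (TensorProduct.map (antipode R ∘ₗ antipode R) (antipode R)
      (TensorProduct.comm R A A (comul a))) = algebraMap R A (counit a) := by
  have h := congrArg (antipode R) (sum_mul_antipode_eq_smul (ℛ R a))
  rw [← (ℛ R a).eq]
  simp only [map_sum, antipode_mul_antidistrib, map_smul, antipode_one] at h
  simp [h, Algebra.algebraMap_eq_smul_one]

variable {T : A →ₗ[R] A}

/-- An inverse `T` of the antipode satisfies `∑ T(a₍₂₎) a₍₁₎ = ε(a)`. -/
theorem mul'_map_invAntipode_id_comm (hT : ∀ a : A, antipode R (T a) = a)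
    (hS : Function.Injective (antipode R : A →ₗ[R] A)) (a : A) :
    LinearMap.mul' R A (TensorProduct.map T .id (TensorProduct.comm R A A (comul a))) =
      algebraMap R A (counit a) := by
  apply hS
  have h := sum_antipode_mul_eq_smul (ℛ R a)
  rw [← (ℛ R a).eq]
  simp [h, Algebra.algebraMap_eq_smul_one, antipode_mul_antidistrib, hT]

/-- An inverse `T` of the antipode satisfies `∑ a₍₂₎ T(a₍₁₎) = ε(a)`. -/
theorem mul'_map_id_invAntipode_comm (hT : ∀ a : A, antipode R (T a) = a)
    (hS : Function.Injective (antipode R : A →ₗ[R] A)) (a : A) :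
    LinearMap.mul' R A (TensorProduct.map .id T (TensorProduct.comm R A A (comul a))) =
      algebraMap R A (counit a) := by
  apply hS
  have h := sum_mul_antipode_eq_smul (ℛ R a)
  rw [← (ℛ R a).eq]
  simp [h, Algebra.algebraMap_eq_smul_one, antipode_mul_antidistrib, hT]

/-- `∑ t₍₁₎ a ⊗ t₍₂₎ = ∑ t₍₁₎ ⊗ t₍₂₎ S(a)` for a right integral `t`. -/
theorem comul_mul_tmul_one_of_right_integral {t : A}
    (ht : ∀ a : A, t * a = counit (R := R) a • t) (a : A) :
    comul (R := R) t * (a ⊗ₜ[R] (1 : A)) = comul t * ((1 : A) ⊗ₜ[R] antipode R a) := by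
  -- Writing `a ⊗ 1 = ∑ Δ(a₍₁₎)(1 ⊗ χ(a₍₂₎))` brings `Δ(t)Δ(a₍₁₎) = Δ(t a₍₁₎)` into play, where the
  -- integral absorbs `a₍₁₎`.
  rw [← sum_lTensor_comul_mul .id (antipode R) mul'_map_id_antipode (ℛ R a), Finset.mul_sum]
  conv_rhs => rw [← sum_counit_smul (ℛ R a)]
  simp only [LinearMap.lTensor_id, LinearMap.id_apply, ← mul_assoc, ← Bialgebra.comul_mul, ht,
    map_sum, map_smul, TensorProduct.tmul_sum, TensorProduct.tmul_smul, Finset.mul_sum,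
    smul_mul_assoc, mul_smul_comm]

/-- `∑ a t₍₁₎ ⊗ S(t₍₂₎) = ∑ t₍₁₎ ⊗ S(t₍₂₎) a` for a left integral `t`. -/
theorem tmul_one_mul_of_left_integral {t : A}
    (ht : ∀ a : A, a * t = counit (R := R) a • t) (a : A) :
    (a ⊗ₜ[R] (1 : A)) * (antipode R).lTensor A (comul t) =
      (antipode R).lTensor A (comul t) * ((1 : A) ⊗ₜ[R] a) := by
  -- Since χ reverses products, `χ(a₍₂₎)` ends up next to `a₍₃₎` and cancels, leaving `a ⊗ 1`. For
  -- `z = Δ(t)` the left side is evaluated instead by `a₍₁₎t = ε(a₍₁₎)t`.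
  have key : ∀ z : A ⊗[R] A, ∑ i ∈ (ℛ R a).index,
      (antipode R).lTensor A (comul ((ℛ R a).left i) * z) * ((1 : A) ⊗ₜ[R] (ℛ R a).right i) =
        (a ⊗ₜ[R] (1 : A)) * (antipode R).lTensor A z := by
    intro z
    induction z with
    | zero => simp
    | add z z' hz hz' => simp only [mul_add, map_add, add_mul, Finset.sum_add_distrib, hz, hz']
    | tmul p q =>
      have h : ∀ (c : A) (w : A ⊗[R] A),
          (antipode R).lTensor A (w * (p ⊗ₜ q)) * ((1 : A) ⊗ₜ[R] c) =
            TensorProduct.map (LinearMap.mulRight R p) (LinearMap.mulLeft R (antipode R q))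
              ((antipode R).lTensor A w * ((1 : A) ⊗ₜ[R] c)) := by
        intro c w
        induction w with
        | zero => simp
        | add w w' hw hw' => simp only [map_add, add_mul, hw, hw']
        | tmul u v => simp [antipode_mul_antidistrib, mul_assoc]
      have e := sum_lTensor_comul_mul (antipode R) .id mul'_map_antipode_id (ℛ R a)
      simp only [LinearMap.id_apply] at e
      simp only [h, ← map_sum, e]
      simp
  rw [← key]
  conv_rhs => rw [← sum_counit_smul (ℛ R a)]
  simp only [← Bialgebra.comul_mul, ht, map_smul, TensorProduct.tmul_sum,
    TensorProduct.tmul_smul, Finset.mul_sum, smul_mul_assoc, mul_smul_comm]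

/-- `∑ a t₍₂₎ ⊗ T(t₍₁₎) = ∑ t₍₂₎ ⊗ T(t₍₁₎) a` for a left integral `t` and an inverse `T` of the
antipode. -/
theorem tmul_one_mul_comm_of_left_integral {T : A →ₗ[R] A}
    (hT : ∀ a : A, antipode R (T a) = a) (hS : Function.Injective (antipode R : A →ₗ[R] A))
    {t : A} (ht : ∀ a : A, a * t = counit (R := R) a • t) (a : A) :
    (a ⊗ₜ[R] (1 : A)) * T.lTensor A (TensorProduct.comm R A A (comul t)) =
      T.lTensor A (TensorProduct.comm R A A (comul t)) * ((1 : A) ⊗ₜ[R] a) := by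
  have T_mul : ∀ x y, T (x * y) = T y * T x := fun x y =>
    hS (by rw [hT, antipode_mul_antidistrib, hT, hT])
  have key : ∀ z : A ⊗[R] A, ∑ i ∈ (ℛ R a).index,
      T.lTensor A (TensorProduct.comm R A A (comul ((ℛ R a).right i) * z)) *
        ((1 : A) ⊗ₜ[R] (ℛ R a).left i) =
        (a ⊗ₜ[R] (1 : A)) * T.lTensor A (TensorProduct.comm R A A z) := by
    intro z
    induction z with
    | zero => simp
    | add z z' hz hz' => simp only [mul_add, map_add, add_mul, Finset.sum_add_distrib, hz, hz']
    | tmul p q =>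
      have h : ∀ (c : A) (w : A ⊗[R] A),
          T.lTensor A (TensorProduct.comm R A A (w * (p ⊗ₜ q))) * ((1 : A) ⊗ₜ[R] c) =
            TensorProduct.map (LinearMap.mulRight R q) (LinearMap.mulLeft R (T p))
              (TensorProduct.comm R A A (T.rTensor A w * (c ⊗ₜ[R] (1 : A)))) := by
        intro c w
        induction w with
        | zero => simp
        | add w w' hw hw' => simp only [map_add, add_mul, hw, hw']
        | tmul u v => simp [T_mul, mul_assoc]
      have e := sum_rTensor_comul_mul T .id (mul'_map_invAntipode_id_comm hT hS) (ℛ R a)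
      simp only [LinearMap.id_apply] at e
      simp only [h, ← map_sum, e]
      simp
  rw [← key]
  conv_rhs => rw [← sum_counit_right_smul (ℛ R a)]
  simp only [← Bialgebra.comul_mul, ht, map_smul, TensorProduct.tmul_sum,
    TensorProduct.tmul_smul, Finset.mul_sum, smul_mul_assoc, mul_smul_comm]

end Sweedler

/-! ### Partial traces -/

section PartialTrace

variable {R : Type u} {A : Type v} [CommRing R] [AddCommGroup A] [Module R A]
  {ι : Type w} [Fintype ι]

/-- The partial trace of a linear map `F : A → A ⊗ A` over the first tensor factor. -/
noncomputable def partialTrace (b : Module.Basis ι R A) : (A →ₗ[R] A ⊗[R] A) →ₗ[R] A :=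
  ∑ i, (TensorProduct.lid R A).toLinearMap ∘ₗ (b.coord i).rTensor A ∘ₗ LinearMap.applyₗ (b i)

theorem partialTrace_apply (b : Module.Basis ι R A) (F : A →ₗ[R] A ⊗[R] A) :
    partialTrace b F = ∑ i, TensorProduct.lid R A ((b.coord i).rTensor A (F (b i))) := by
  simp [partialTrace, LinearMap.sum_apply]

/-- Cyclicity of the trace: in the matrix entries of `h` both sides are the same double sum, with
the order of summation exchanged. -/
theorem partialTrace_rTensor_comp (b : Module.Basis ι R A) (F : A →ₗ[R] A ⊗[R] A)
    (h : A →ₗ[R] A) : partialTrace b (h.rTensor A ∘ₗ F) = partialTrace b (F ∘ₗ h) := by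
  have e1 : ∀ i, (b.coord i).rTensor A ∘ₗ h.rTensor A =
      ∑ j, b.coord i (h (b j)) • (b.coord j).rTensor A := by
    intro i
    rw [← LinearMap.rTensor_comp]
    have : b.coord i ∘ₗ h = ∑ j, b.coord i (h (b j)) • b.coord j := by
      refine b.ext fun k => ?_
      classical
      simp [LinearMap.sum_apply, Finsupp.single_apply]
    rw [this]
    refine TensorProduct.ext' fun p q => ?_
    simp [LinearMap.sum_apply, TensorProduct.sum_tmul, TensorProduct.smul_tmul']
  have e2 : ∀ i, F (h (b i)) = ∑ j, b.coord j (h (b i)) • F (b j) := by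
    intro i
    have := congrArg F (b.sum_repr (h (b i)))
    simpa only [map_sum, map_smul, Module.Basis.coord_apply] using this.symm
  simp only [partialTrace_apply, LinearMap.comp_apply, e2]
  have e3 : ∀ i z, (b.coord i).rTensor A (h.rTensor A z) =
      ∑ j, b.coord i (h (b j)) • (b.coord j).rTensor A z := fun i z => by
    rw [← LinearMap.comp_apply, e1, LinearMap.sum_apply]; rfl
  simp only [e3, map_sum, map_smul]
  exact Finset.sum_comm

end PartialTrace

/-! ### Existence of integrals by a trace formula -/

section Integral

variable {R : Type u} {A : Type v} [CommRing R] [Ring A] [HopfAlgebra R A]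

/-- The map `y ↦ ∑ c S²(y₍₁₎) ⊗ y₍₂₎`. -/
noncomputable def mulAntipodeSqComul (R : Type u) {A : Type v} [CommRing R] [Ring A]
    [HopfAlgebra R A] (c : A) : A →ₗ[R] A ⊗[R] A :=
  (LinearMap.mulLeft R c ∘ₗ antipode R ∘ₗ antipode R).rTensor A ∘ₗ comul

/-- Holds because `Δ` and `χ²` are both multiplicative. The square of χ is there so that `∑
χ²(a₍₂₎)χ(a₍₁₎) = ε(a)` can be applied afterwards. -/
theorem mulAntipodeSqComul_mul (c y z : A) : mulAntipodeSqComul R c (y * z) =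
    mulAntipodeSqComul R c y * (antipode R ∘ₗ antipode R).rTensor A (comul z) := by
  have key : ∀ p q : A ⊗[R] A,
      (LinearMap.mulLeft R c ∘ₗ antipode R ∘ₗ antipode R).rTensor A (p * q) =
        (LinearMap.mulLeft R c ∘ₗ antipode R ∘ₗ antipode R).rTensor A p *
          (antipode R ∘ₗ antipode R).rTensor A q := by
    intro p q
    induction p with
    | zero => simp
    | add p p' hp hp' => simp only [map_add, add_mul, hp, hp']
    | tmul u v =>
      induction q with
      | zero => simp
      | add q q' hq hq' => simp only [map_add, mul_add, hq, hq']
      | tmul u' v' => simp [antipode_mul_antidistrib, mul_assoc]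
  simp only [mulAntipodeSqComul, LinearMap.comp_apply, Bialgebra.comul_mul]
  exact key _ _

/-- The element `t` with `f(t) = tr(y ↦ ∑ c S²(y₍₁₎) f(y₍₂₎))` is a right integral. -/
theorem partialTrace_mulAntipodeSqComul_mul {ι : Type w} [Fintype ι] (b : Module.Basis ι R A)
    (c a : A) : partialTrace b (mulAntipodeSqComul R c) * a =
      counit (R := R) a • partialTrace b (mulAntipodeSqComul R c) := by
  have h1 : ∀ F : A →ₗ[R] A ⊗[R] A, partialTrace b F * a =
      partialTrace b ((LinearMap.mulRight R a).lTensor A ∘ₗ F) := by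
    intro F
    have : ∀ (f : A →ₗ[R] R) (z : A ⊗[R] A), TensorProduct.lid R A (f.rTensor A z) * a =
        TensorProduct.lid R A (f.rTensor A ((LinearMap.mulRight R a).lTensor A z)) := by
      intro f z
      induction z with
      | zero => simp
      | add z z' hz hz' => simp only [map_add, add_mul, hz, hz']
      | tmul p q => simp
    simp only [partialTrace_apply, Finset.sum_mul, this, LinearMap.comp_apply]
  -- With `F(y) = ∑ cχ²(y₍₁₎) ⊗ y₍₂₎`, this is `F(y)(1 ⊗ a) = ∑ F(y a₍₂₎)(χ(a₍₁₎) ⊗ 1)`. Cyclicity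
  -- then merges the two multiplications into one by `∑ χ(a₍₁₎)a₍₂₎ = ε(a)`.
  have h2 : (LinearMap.mulRight R a).lTensor A ∘ₗ mulAntipodeSqComul R c =
      ∑ i ∈ (ℛ R a).index, (LinearMap.mulRight R (antipode R ((ℛ R a).left i))).rTensor A ∘ₗ
        mulAntipodeSqComul R c ∘ₗ LinearMap.mulRight R ((ℛ R a).right i) := by
    have hR : ∀ (x : A) (z : A ⊗[R] A),
        (LinearMap.mulRight R x).rTensor A z = z * (x ⊗ₜ[R] (1 : A)) := by
      intro x z
      induction z with
      | zero => simp
      | add z z' hz hz' => simp only [map_add, add_mul, hz, hz']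
      | tmul p q => simp
    have hL : ∀ (x : A) (z : A ⊗[R] A),
        (LinearMap.mulRight R x).lTensor A z = z * ((1 : A) ⊗ₜ[R] x) := by
      intro x z
      induction z with
      | zero => simp
      | add z z' hz hz' => simp only [map_add, add_mul, hz, hz']
      | tmul p q => simp
    ext y
    simp only [LinearMap.comp_apply, LinearMap.sum_apply, hR, hL, LinearMap.mulRight_apply,
      mulAntipodeSqComul_mul, mul_assoc, ← Finset.mul_sum]
    rw [sum_rTensor_comul_mul _ _ mul'_map_antipode_sq_antipode_comm]
  have h3 : ∀ x y : A, partialTrace b ((LinearMap.mulRight R x).rTensor A ∘ₗ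
      mulAntipodeSqComul R c ∘ₗ LinearMap.mulRight R y) =
        partialTrace b ((LinearMap.mulRight R (x * y)).rTensor A ∘ₗ mulAntipodeSqComul R c) := by
    intro x y
    rw [← LinearMap.comp_assoc, ← partialTrace_rTensor_comp, ← LinearMap.comp_assoc,
      ← LinearMap.rTensor_comp, LinearMap.mulRight_mul]
  rw [h1, h2, map_sum]
  simp only [h3]
  have h5 : ∑ i ∈ (ℛ R a).index, LinearMap.mulRight R
      (antipode R ((ℛ R a).left i) * (ℛ R a).right i) =
        counit (R := R) a • LinearMap.id (M := A) := by
    ext y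
    simp only [LinearMap.sum_apply, LinearMap.mulRight_apply, ← Finset.mul_sum,
      sum_antipode_mul_eq_smul]
    simp
  have h6 := congrArg (partialTrace b ∘ₗ
    (LinearMap.lcomp R _ (mulAntipodeSqComul R c)) ∘ₗ LinearMap.rTensorHom A) h5
  simpa only [map_sum, map_smul, LinearMap.comp_apply, LinearMap.lcomp_apply',
    LinearMap.coe_rTensorHom, LinearMap.rTensor_id, LinearMap.id_comp] using h6

/-- `∑ⱼ eʲ(tⱼ) = 1` where `eʲ` is dual to the basis `eⱼ` and `tⱼ` is the right integral
`f(tⱼ) = tr(y ↦ ∑ S(eⱼ) S²(y₍₁₎) f(y₍₂₎))`. -/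
theorem sum_coord_partialTrace_mulAntipodeSqComul {ι : Type w} [Fintype ι]
    (b : Module.Basis ι R A) :
    ∑ j, b.coord j (partialTrace b (mulAntipodeSqComul R (antipode R (b j)))) = 1 := by
  -- Summing over `j` replaces `eⱼ` by the second tensor factor `q`, and `χ(q)χ²(p) = χ(χ(p)q)`. For
  -- `z = Δ(eᵢ)` the antipode axiom turns this into `ε(eᵢ)1`, so the total is `ε(1) = 1`.
  have key : ∀ (f : A →ₗ[R] R) (z : A ⊗[R] A),
      ∑ j, b.coord j (TensorProduct.lid R A (f.rTensor A
        ((LinearMap.mulLeft R (antipode R (b j)) ∘ₗ antipode R ∘ₗ antipode R).rTensor A z))) =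
        f (antipode R (LinearMap.mul' R A ((antipode R).rTensor A z))) := by
    intro f z
    induction z with
    | zero => simp
    | add z z' hz hz' => simp only [map_add, Finset.sum_add_distrib, hz, hz']
    | tmul p q =>
      have hq := congrArg (f ∘ₗ LinearMap.mulRight R (antipode R (antipode R p)) ∘ₗ antipode R)
        (b.sum_repr q)
      simp only [map_sum, map_smul, LinearMap.comp_apply, LinearMap.mulRight_apply,
        smul_eq_mul] at hq
      simp [antipode_mul_antidistrib, mul_comm, hq]
  simp only [partialTrace_apply, map_sum]
  rw [Finset.sum_comm]
  simp only [mulAntipodeSqComul, LinearMap.comp_apply] at key ⊢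
  simp only [key, mul_antipode_rTensor_comul_apply, Algebra.algebraMap_eq_smul_one, map_smul,
    antipode_one]
  have := congrArg (counit (R := R)) (b.sum_repr (1 : A))
  simp only [map_sum, map_smul, smul_eq_mul, Bialgebra.counit_one] at this
  simpa only [Module.Basis.coord_apply, smul_eq_mul, mul_comm] using this

/-- A finite Hopf algebra over a local ring has a right integral that takes the value `1` on some
linear form. -/
theorem exists_right_integral [IsLocalRing R] [Module.Finite R A] [Module.Projective R A] :
    ∃ (t : A) (f : A →ₗ[R] R), (∀ a : A, t * a = counit (R := R) a • t) ∧ f t = 1 := by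
  have : Module.Free R A := Module.free_of_flat_of_isLocalRing
  let b := Module.Free.chooseBasis R A
  -- In a local ring, a sum equal to 1 has a unit among its terms; dividing the coordinate form by
  -- that unit normalises it.
  obtain ⟨j, -, hj⟩ := IsLocalRing.exists_of_isUnit_sum
    (sum_coord_partialTrace_mulAntipodeSqComul (R := R) b ▸ isUnit_one)
  obtain ⟨r, hr⟩ := hj
  exact ⟨_, (↑r⁻¹ : R) • b.coord j, fun a => partialTrace_mulAntipodeSqComul_mul b _ a, by
    rw [LinearMap.smul_apply, ← hr, smul_eq_mul, Units.inv_mul]⟩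

end Integral

/-! ### The Frobenius form and bijectivity of the antipode -/

section Frobenius

variable {R : Type u} {A : Type v} [CommRing R] [Ring A] [HopfAlgebra R A]

/-- The map `A* → A`, `f ↦ ∑ t₍₁₎ f(t₍₂₎)`. -/
noncomputable def dualToSelf (R : Type u) {A : Type v} [CommRing R] [Ring A] [HopfAlgebra R A]
    (t : A) : (A →ₗ[R] R) →ₗ[R] A :=
  (TensorProduct.rid R A).toLinearMap ∘ₗ LinearMap.applyₗ (comul t) ∘ₗ LinearMap.lTensorHom A

theorem dualToSelf_apply (t : A) (f : A →ₗ[R] R) :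
    dualToSelf R t f = TensorProduct.rid R A (f.lTensor A (comul t)) := rfl

/-- Makes the image of `dualToSelf R t` a right ideal, so that surjectivity only requires reaching
1. -/
theorem dualToSelf_comp_mulRight {t : A} (ht : ∀ a : A, t * a = counit (R := R) a • t)
    (f : A →ₗ[R] R) (a : A) :
    dualToSelf R t (f ∘ₗ LinearMap.mulRight R (antipode R a)) = dualToSelf R t f * a := by
  have h1 : ∀ (x : A) (z : A ⊗[R] A), (f ∘ₗ LinearMap.mulRight R x).lTensor A z =
      f.lTensor A (z * ((1 : A) ⊗ₜ[R] x)) := by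
    intro x z
    induction z with
    | zero => simp
    | add z z' hz hz' => simp only [map_add, add_mul, hz, hz']
    | tmul p q => simp
  have h2 : ∀ z : A ⊗[R] A, TensorProduct.rid R A (f.lTensor A (z * (a ⊗ₜ[R] (1 : A)))) =
      TensorProduct.rid R A (f.lTensor A z) * a := by
    intro z
    induction z with
    | zero => simp
    | add z z' hz hz' => simp only [map_add, add_mul, hz, hz']
    | tmul p q => simp
  rw [dualToSelf_apply, dualToSelf_apply, h1, ← comul_mul_tmul_one_of_right_integral ht, h2]

/-- If `t` is a right integral with `f(t) = 1`, then `∑ t₍₁₎ θ(t₍₂₎) = 1` for some `θ`. -/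
theorem exists_dualToSelf_eq_one [Module.Finite R A] [Module.Free R A] {t : A}
    (ht : ∀ a : A, t * a = counit (R := R) a • t) {f : A →ₗ[R] R} (hf : f t = 1) :
    ∃ θ, dualToSelf R t θ = 1 := by
  let b := Module.Free.chooseBasis R A
  -- `N(q) = ∑ χ(q₍₁₎)f(q₍₂₎)` is chosen so that `∑ t₍₁₎N(t₍₂₎) = ∑ t₍₁₎χ(t₍₂₎)f(t₍₃₎) = f(t)1 = 1`.
  let N : A →ₗ[R] A := (TensorProduct.rid R A).toLinearMap ∘ₗ
    TensorProduct.map (antipode R) f ∘ₗ comul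
  have h1 : ∀ z : A ⊗[R] A, ∑ i, TensorProduct.rid R A ((b.coord i).lTensor A z) * N (b i) =
      LinearMap.mul' R A (N.lTensor A z) := by
    intro z
    induction z with
    | zero => simp
    | add z z' hz hz' => simp only [map_add, add_mul, Finset.sum_add_distrib, hz, hz']
    | tmul p q =>
      have hq := congrArg (LinearMap.mulLeft R p ∘ₗ N) (b.sum_repr q)
      simp only [map_sum, map_smul, LinearMap.comp_apply, LinearMap.mulLeft_apply] at hq
      simp [hq]
  have h2 : ∀ z : A ⊗[R] A, ∀ q : A, LinearMap.mul' R A (((TensorProduct.rid R A).toLinearMap ∘ₗ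
      TensorProduct.map (antipode R) f).lTensor A (TensorProduct.assoc R A A A (z ⊗ₜ q))) =
        f q • LinearMap.mul' R A ((antipode R).lTensor A z) := by
    intro z q
    induction z with
    | zero => simp
    | add z z' hz hz' => simp only [map_add, TensorProduct.add_tmul, smul_add, hz, hz']
    | tmul p q => simp
  have h3 : LinearMap.mul' R A (N.lTensor A (comul t)) = 1 := by
    have e := congrArg (fun z => LinearMap.mul' R A (((TensorProduct.rid R A).toLinearMap ∘ₗ
      TensorProduct.map (antipode R) f).lTensor A z)) (coassoc_apply (R := R) t)
    rw [← LinearMap.comp_apply (LinearMap.lTensor A _) (LinearMap.lTensor A _),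
      ← LinearMap.lTensor_comp] at e
    refine Eq.trans e.symm ?_
    conv_lhs => rw [← (ℛ R t).eq]
    simp only [map_sum, LinearMap.rTensor_tmul, h2, mul_antipode_lTensor_comul_apply]
    have := congrArg f (sum_counit_smul (ℛ R t))
    rw [hf] at this
    simp only [map_sum, map_smul, smul_eq_mul] at this
    simp only [Algebra.algebraMap_eq_smul_one, smul_smul, ← Finset.sum_smul]
    rw [Finset.sum_congr rfl fun i _ => mul_comm (f ((ℛ R t).right i)) _, this, one_smul]
  -- Expanding `t₍₂₎` in the basis exhibits `∑ t₍₁₎N(t₍₂₎)` as an element of the right ideal; this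
  -- form is its preimage.
  refine ⟨∑ i, b.coord i ∘ₗ LinearMap.mulRight R (antipode R (N (b i))), ?_⟩
  exact (map_sum (dualToSelf R t) _ _).trans ((Finset.sum_congr rfl fun i _ =>
    dualToSelf_comp_mulRight ht _ _).trans ((h1 _).trans h3))

/-- A finite Hopf algebra over a local ring has bijective antipode, and its dual is a free left
module of rank one. -/
theorem exists_frobenius_form [IsLocalRing R] [Module.Finite R A] [Module.Projective R A] :
    Function.Bijective (antipode R : A →ₗ[R] A) ∧
      ∃ θ : HopfDual R A, Function.Bijective fun a : A => a • θ := by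
  have : Module.Free R A := Module.free_of_flat_of_isLocalRing
  obtain ⟨t, f, ht, hf⟩ := exists_right_integral (R := R) (A := A)
  obtain ⟨θ, hθ⟩ := exists_dualToSelf_eq_one ht hf
  have hinv : ∀ a : A, dualToSelf R t (θ ∘ₗ LinearMap.mulRight R (antipode R a)) = a := by
    intro a
    rw [dualToSelf_comp_mulRight ht, hθ, one_mul]
  have hrank : Module.finrank R (A →ₗ[R] R) = Module.finrank R A := by
    rw [Module.finrank_linearMap, Module.finrank_self, mul_one]
  have hφ : Function.Bijective (dualToSelf R t) :=
    OrzechProperty.bijective_of_surjective_of_finrank_le _ (fun a => ⟨_, hinv a⟩) hrank.le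
  let act : A →ₗ[R] (A →ₗ[R] R) := (LinearMap.mul R A).flip.compr₂ θ
  have hact : ∀ a, act a = θ ∘ₗ LinearMap.mulRight R a := fun a => rfl
  have hactS : Function.Bijective (act ∘ antipode R) := by
    have : Function.LeftInverse (dualToSelf R t) (act ∘ antipode R) := hinv
    refine ⟨this.injective, fun g => ⟨dualToSelf R t g, hφ.1 (hinv _)⟩⟩
  -- `act ∘ χ` inverts `dualToSelf R t`, so `act` is onto, hence bijective by equality of ranks;
  -- cancelling it leaves χ bijective.
  have hb : Function.Bijective act :=
    OrzechProperty.bijective_of_surjective_of_finrank_le _ hactS.2.of_comp hrank.ge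
  refine ⟨(Function.Bijective.of_comp_iff' hb _).1 hactS, WithConv.toConv θ, ?_⟩
  exact (WithConv.toConv_bijective).comp hb

end Frobenius

/-! ### Tameness and `A`-linear maps from the dual -/

section Tame

variable {R : Type u} {A : Type v} [CommRing R] [Ring A] [HopfAlgebra R A]

theorem mem_leftIntegrals {t : A} :
    t ∈ leftIntegrals R A ↔ ∀ a : A, a * t = counit (R := R) a • t := Iff.rfl

theorem HopfDual.smul_one (a : A) : a • (1 : HopfDual R A) = counit (R := R) a • 1 :=
  WithConv.ext (LinearMap.ext fun b => by
    simp [HopfDual.smul_apply, mul_comm])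

/-- `(tf)(b) = f(bt) = ε(b)f(t)`. -/
theorem HopfDual.smul_of_mem_leftIntegrals {t : A} (ht : t ∈ leftIntegrals R A)
    (f : HopfDual R A) : t • f = f.ofConv t • (1 : HopfDual R A) :=
  WithConv.ext (LinearMap.ext fun b => by
    simp [HopfDual.smul_apply, mem_leftIntegrals.1 ht, mul_comm])

/-- The element `t` with `t θ = ε` for a generator `θ` of `A*` is a left integral. -/
theorem mem_leftIntegrals_of_smul_eq_one {θ : HopfDual R A}
    (hθ : Function.Injective fun a : A => a • θ) {t : A} (ht : t • θ = 1) :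
    t ∈ leftIntegrals R A := by
  refine mem_leftIntegrals.2 fun a => hθ ?_
  change (a * t) • θ = (counit (R := R) a • t) • θ
  rw [mul_smul, smul_assoc, ht, HopfDual.smul_one]

/-- Every left integral is a multiple of the element `t` with `t θ = ε`. -/
theorem eq_smul_of_mem_leftIntegrals {θ : HopfDual R A}
    (hθ : Function.Injective fun a : A => a • θ) {t : A} (ht : t • θ = 1) {t' : A}
    (ht' : t' ∈ leftIntegrals R A) : t' = θ.ofConv t' • t := by
  apply hθ
  change t' • θ = (θ.ofConv t' • t) • θ
  rw [smul_assoc, ht, HopfDual.smul_of_mem_leftIntegrals ht']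

/-- An `A`-linear map `g : A* → S` with `g(1) = 1` from an element `s` with `t s = 1`. -/
theorem exists_hom_of_smul_eq_one {S : Type w} [Ring S] [Module A S] {θ : HopfDual R A}
    (hθ : Function.Bijective fun a : A => a • θ) {t : A} (ht : t • θ = 1)
    {s : S} (hs : t • s = 1) : ∃ g : HopfDual R A →ₗ[A] S, g 1 = 1 := by
  -- The map is `aθ ↦ as`; the unit of `A*` is `tθ`, so it goes to `ts = 1`.
  let e : A ≃ₗ[A] HopfDual R A := LinearEquiv.ofBijective (LinearMap.toSpanSingleton A _ θ) hθ
  have he : e.symm 1 = t := by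
    rw [LinearEquiv.symm_apply_eq]
    exact ht.symm
  exact ⟨LinearMap.toSpanSingleton A S s ∘ₗ e.symm.toLinearMap, by simp [he, hs]⟩

variable {S : Type w} [Ring S] [Algebra R S] [Module A S] [IsScalarTower R A S]

/-- All integrals are multiples of `t`, so the span `IS` lies in the image of the single operator
`t`; no sum of several terms is needed to reach 1. -/
theorem exists_smul_eq_one_of_integralImage {θ : HopfDual R A}
    (hθ : Function.Injective fun a : A => a • θ) {t : A} (ht : t • θ = 1)
    (hS : integralImage R A S = LinearMap.range (Algebra.linearMap R S)) :
    ∃ s : S, t • s = 1 := by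
  have h1 : (1 : S) ∈ integralImage R A S := hS ▸ ⟨1, map_one (algebraMap R S)⟩
  have hle : integralImage R A S ≤
      LinearMap.range ((DistribSMul.toLinearMap R S t : S →ₗ[R] S)) := by
    refine Submodule.span_le.2 ?_
    rintro _ ⟨t', ht', s, rfl⟩
    refine ⟨θ.ofConv t' • s, ?_⟩
    change t • θ.ofConv t' • s = t' • s
    conv_rhs => rw [eq_smul_of_mem_leftIntegrals hθ ht ht']
    rw [smul_comm, smul_assoc]
  exact hle h1

/-- `a(t's) = ε(a)t's` puts `IS` inside `S^A = R`, and `1 = g(tθ) = t g(θ)` gives the reverse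
inclusion. -/
theorem integralImage_eq_of_hom (hfixed : FixedPointsEqBase R A S) {t : A}
    (ht : t ∈ leftIntegrals R A) {θ : HopfDual R A} (htθ : t • θ = 1)
    (g : HopfDual R A →ₗ[A] S) (hg : g 1 = 1) :
    integralImage R A S = LinearMap.range (Algebra.linearMap R S) := by
  apply le_antisymm
  · rw [← hfixed.2]
    refine Submodule.span_le.2 ?_
    rintro _ ⟨t', ht', s, rfl⟩ a
    rw [← mul_smul, mem_leftIntegrals.1 ht', smul_assoc]
  · rintro _ ⟨r, rfl⟩
    rw [Algebra.linearMap_apply, Algebra.algebraMap_eq_smul_one]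
    refine Submodule.smul_mem _ r (Submodule.subset_span ⟨t, ht, g θ, ?_⟩)
    rw [← map_smul, htθ, hg]

/-- `S` is tame if and only if there is an `A`-linear map `g : A* → S` with `g(1) = 1`. -/
theorem isTameExtension_iff_exists_hom [IsLocalRing R] [Module.Finite R A]
    [Module.Projective R A] [Module.Finite R S] [Module.Projective R S]
    (hS : IsModuleAlgebra R A S) (hfaithful : ∀ a : A, (∀ s : S, a • s = 0) → a = 0)
    (hrank : Module.finrank R S = Module.finrank R A) (hfixed : FixedPointsEqBase R A S) :
    IsTameExtension R A S ↔ ∃ g : HopfDual R A →ₗ[A] S, g 1 = 1 := by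
  obtain ⟨-, θ, hθ⟩ := exists_frobenius_form (R := R) (A := A)
  obtain ⟨t, ht⟩ := hθ.2 1
  constructor
  · intro h
    obtain ⟨s, hs⟩ := exists_smul_eq_one_of_integralImage hθ.1 ht h.integralImage_eq
    exact exists_hom_of_smul_eq_one hθ ht hs
  · rintro ⟨g, hg⟩
    exact
      { finite := inferInstance
        projective := inferInstance
        moduleAlgebra := hS
        fixedPoints := hfixed
        rank_eq := hrank
        faithful := hfaithful
        integralImage_eq := integralImage_eq_of_hom hfixed
          (mem_leftIntegrals_of_smul_eq_one hθ.1 ht) ht g hg }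

end Tame

/-! ### Comodules over the dual as modules, averaging, and injectivity -/

section Comodule

variable {R : Type u} {A : Type v} [CommRing R] [Ring A] [HopfAlgebra R A]
  [Module.Finite R A] [Module.Projective R A]
  {M : Type x} [AddCommGroup M] [Module R M] {N : Type y} [AddCommGroup N] [Module R N]

/-- The action `(a, m) ↦ ∑ m₍₁₎(a) m₍₀₎` of `A` on a right `A*`-comodule. -/
noncomputable def comoduleAction (ρ : M →ₗ[R] M ⊗[R] HopfDual R A) : A →ₗ[R] M →ₗ[R] M :=
  ((tensorDualEquiv R A M).toLinearMap ∘ₗ ρ).flip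

theorem comoduleAction_apply (ρ : M →ₗ[R] M ⊗[R] HopfDual R A) (a : A) (m : M) :
    comoduleAction ρ a m = tensorDualEquiv R A M (ρ m) a := rfl

theorem tensorDualEquiv_rTensor (f : M →ₗ[R] N) (z : M ⊗[R] HopfDual R A) (a : A) :
    tensorDualEquiv R A N (f.rTensor (HopfDual R A) z) a = f (tensorDualEquiv R A M z a) := by
  induction z with
  | zero => simp
  | add z z' hz hz' => simp only [map_add, LinearMap.add_apply, hz, hz']
  | tmul m g => simp [tensorDualEquiv_tmul]

/-- Translates colinearity into `A`-linearity. The action is a bilinear map and not a `Module`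
instance, since it depends on the coaction. -/
theorem isComoduleHom_iff (ρ : M →ₗ[R] M ⊗[R] HopfDual R A) (σ : N →ₗ[R] N ⊗[R] HopfDual R A)
    (f : M →ₗ[R] N) : IsComoduleHom ρ σ f ↔
      ∀ a m, f (comoduleAction ρ a m) = comoduleAction σ a (f m) := by
  simp only [comoduleAction_apply, ← tensorDualEquiv_rTensor]
  constructor
  · intro h a m
    rw [h m]
  · intro h m
    exact (tensorDualEquiv R A N).injective (LinearMap.ext fun a => (h a m).symm)

/-- Evaluates the last factor at `a` and the middle one at `b`, using `∑ f₍₁₎(b)f₍₂₎(a) = f(ba)`. It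
turns coassociativity into associativity of the action. -/
theorem tensorDualEquiv_lTensor_comul (z : M ⊗[R] HopfDual R A) (a b : A) :
    tensorDualEquiv R A M (tensorDualEquiv R A (M ⊗[R] HopfDual R A)
      ((TensorProduct.assoc R M (HopfDual R A) (HopfDual R A)).symm
        ((comul (R := R) (A := HopfDual R A)).lTensor M z)) a) b =
      tensorDualEquiv R A M z (b * a) := by
  have h : ∀ (n : M) (t : HopfDual R A ⊗[R] HopfDual R A),
      tensorDualEquiv R A (M ⊗[R] HopfDual R A)
        ((TensorProduct.assoc R M (HopfDual R A) (HopfDual R A)).symm (n ⊗ₜ t)) a =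
      n ⊗ₜ[R] (tensorDualEquiv R A (HopfDual R A) t a) := by
    intro n t
    induction t with
    | zero => simp
    | add z z' hz hz' => simp [TensorProduct.tmul_add, hz, hz']
    | tmul f g => simp [tensorDualEquiv_tmul]
  induction z with
  | zero => simp
  | add z z' hz hz' => simp only [map_add, LinearMap.add_apply, hz, hz']
  | tmul n f =>
    rw [LinearMap.lTensor_tmul, h]
    change tensorDualEquiv R A M
      (n ⊗ₜ tensorDualEquiv R A _ (inducedCoaction R A _ f) a) b = _
    rw [tensorDualEquiv_inducedCoaction, tensorDualEquiv_tmul, tensorDualEquiv_tmul,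
      HopfDual.smul_apply]

theorem comoduleAction_mul {ρ : M →ₗ[R] M ⊗[R] HopfDual R A} (hρ : IsRightComodule ρ)
    (a b : A) (m : M) :
    comoduleAction ρ (a * b) m = comoduleAction ρ a (comoduleAction ρ b m) := by
  have h := (TensorProduct.assoc R M (HopfDual R A) (HopfDual R A)).eq_symm_apply.2
    (hρ.coassoc m)
  simp only [comoduleAction_apply]
  rw [← tensorDualEquiv_lTensor_comul, ← h, tensorDualEquiv_rTensor]

theorem comoduleAction_one {ρ : M →ₗ[R] M ⊗[R] HopfDual R A} (hρ : IsRightComodule ρ)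
    (m : M) : comoduleAction ρ 1 m = m := by
  have h : ∀ z : M ⊗[R] HopfDual R A, TensorProduct.rid R M
      ((counit (R := R) (A := HopfDual R A)).lTensor M z) = tensorDualEquiv R A M z 1 := by
    intro z
    induction z with
    | zero => simp
    | add z z' hz hz' => simp only [map_add, LinearMap.add_apply, hz, hz']
    | tmul n f => rfl
  rw [comoduleAction_apply, ← h, hρ.counit, TensorProduct.rid_tmul, one_smul]

theorem comoduleAction_inducedCoaction [Module A M] [IsScalarTower R A M] (a : A) (m : M) :
    comoduleAction (inducedCoaction R A M) a m = a • m :=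
  tensorDualEquiv_inducedCoaction R A M m a

/-- Under `M ⊗ A* ≃ Hom(A, M)` the product of coactions becomes
`a ↦ ∑ β(z(a₍₁₎), z'(a₍₂₎))`. -/
theorem tensorDualEquiv_map₂ {P : Type w} [AddCommGroup P] [Module R P]
    (β : M →ₗ[R] N →ₗ[R] P) (z : M ⊗[R] HopfDual R A) (z' : N ⊗[R] HopfDual R A) (a : A) :
    tensorDualEquiv R A P (TensorProduct.map₂ β (LinearMap.mul R (HopfDual R A)) z z') a =
      TensorProduct.lift (β.compl₁₂ (tensorDualEquiv R A M z) (tensorDualEquiv R A N z'))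
        (comul a) := by
  rw [← (ℛ R a).eq]
  simp only [map_sum, TensorProduct.lift.tmul, LinearMap.compl₁₂_apply]
  induction z with
  | zero => simp
  | add z₁ z₂ h₁ h₂ => simp only [map_add, LinearMap.add_apply, h₁, h₂, Finset.sum_add_distrib]
  | tmul m f =>
    induction z' with
    | zero => simp
    | add z₁ z₂ h₁ h₂ =>
      simp only [map_add, LinearMap.add_apply, h₁, h₂, Finset.sum_add_distrib]
    | tmul n g =>
      rw [TensorProduct.map₂_apply_tmul, TensorProduct.map_tmul, tensorDualEquiv_tmul,
        LinearMap.mul_apply']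
      simp only [tensorDualEquiv_tmul, map_smul, LinearMap.smul_apply, smul_smul,
        ← Finset.sum_smul]
      congr 1
      refine ((ℛ R a).convMul_apply f g).trans (Finset.sum_congr rfl fun i _ => ?_)
      exact mul_comm _ _

/-- The map `∑ uᵢ ⊗ vᵢ ↦ (n ↦ ∑ uᵢ h(vᵢ n))`. -/
noncomputable def average (ρ : M →ₗ[R] M ⊗[R] HopfDual R A) (σ : N →ₗ[R] N ⊗[R] HopfDual R A)
    (h : N →ₗ[R] M) : A ⊗[R] A →ₗ[R] N →ₗ[R] M :=
  TensorProduct.lift ((LinearMap.llcomp R N M M).compl₁₂ (comoduleAction ρ)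
    (LinearMap.llcomp R N N M h ∘ₗ comoduleAction σ))

theorem average_tmul (ρ : M →ₗ[R] M ⊗[R] HopfDual R A) (σ : N →ₗ[R] N ⊗[R] HopfDual R A)
    (h : N →ₗ[R] M) (a b : A) (n : N) : average ρ σ h (a ⊗ₜ b) n =
      comoduleAction ρ a (h (comoduleAction σ b n)) := rfl

/-- The identity `hw` says that acting by `a` before or after the average gives the same map,
whatever the linear map `h`. -/
theorem isComoduleHom_average {ρ : M →ₗ[R] M ⊗[R] HopfDual R A} (hρ : IsRightComodule ρ)
    {σ : N →ₗ[R] N ⊗[R] HopfDual R A} (hσ : IsRightComodule σ) (h : N →ₗ[R] M)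
    {w : A ⊗[R] A} (hw : ∀ a : A, (a ⊗ₜ[R] (1 : A)) * w = w * ((1 : A) ⊗ₜ[R] a)) :
    IsComoduleHom σ ρ (average ρ σ h w) := by
  refine (isComoduleHom_iff σ ρ _).2 fun a n => ?_
  have h1 : ∀ z : A ⊗[R] A, average ρ σ h z (comoduleAction σ a n) =
      average ρ σ h (z * ((1 : A) ⊗ₜ[R] a)) n := by
    intro z
    induction z with
    | zero => simp
    | add z z' hz hz' => simp only [map_add, add_mul, LinearMap.add_apply, hz, hz']
    | tmul p q => simp [average_tmul, comoduleAction_mul hσ]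
  have h2 : ∀ z : A ⊗[R] A, comoduleAction ρ a (average ρ σ h z n) =
      average ρ σ h ((a ⊗ₜ[R] (1 : A)) * z) n := by
    intro z
    induction z with
    | zero => simp
    | add z z' hz hz' => simp only [map_add, mul_add, LinearMap.add_apply, hz, hz']
    | tmul p q => simp [average_tmul, comoduleAction_mul hρ]
  rw [h1, h2, hw]

/-- A comodule over a field is injective if an average of some linear endomorphism is the
identity. -/
theorem isInjectiveComodule_of_average_eq_id (hR : IsField R)
    {ρ : M →ₗ[R] M ⊗[R] HopfDual R A} (hρ : IsRightComodule ρ) {w : A ⊗[R] A}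
    (hw : ∀ a : A, (a ⊗ₜ[R] (1 : A)) * w = w * ((1 : A) ⊗ₜ[R] a)) (k : M →ₗ[R] M)
    (hk : average ρ ρ k w = .id) : IsInjectiveComodule.{u, max u v, x, y} ρ := by
  intro X Y _ _ _ _ ρX ρY hX hY i f hi hinj hf
  obtain ⟨l, hl⟩ : ∃ l : Y →ₗ[R] X, l ∘ₗ i = .id := by
    let := hR.toField
    exact LinearMap.exists_leftInverse_of_injective i (LinearMap.ker_eq_bot.2 hinj)
  refine ⟨average ρ ρY (k ∘ₗ f ∘ₗ l) w, isComoduleHom_average hρ hY _ hw,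
    LinearMap.ext fun a => ?_⟩
  -- The inner action passes through `i`, then `l ∘ i` cancels, then the action passes through `f`.
  have key : ∀ z : A ⊗[R] A, average ρ ρY (k ∘ₗ f ∘ₗ l) z (i a) = average ρ ρ k z (f a) := by
    intro z
    induction z with
    | zero => simp
    | add z z' hz hz' => simp only [map_add, LinearMap.add_apply, hz, hz']
    | tmul p q =>
      rw [average_tmul, average_tmul, ← (isComoduleHom_iff _ _ _).1 hi,
        ← (isComoduleHom_iff _ _ _).1 hf, LinearMap.comp_apply, LinearMap.comp_apply,
        ← LinearMap.comp_apply l i, hl, LinearMap.id_apply]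
  rw [LinearMap.comp_apply, key, hk, LinearMap.id_apply]

end Comodule

/-! ### Relative Hopf modules are injective -/

section RelativeHopfModule

variable {R : Type u} {A : Type v} [CommRing R] [Ring A] [HopfAlgebra R A]
  [Module.Finite R A] [Module.Projective R A]
  {S : Type w} [Ring S] [Algebra R S] [Module A S] [IsScalarTower R A S]
  {M : Type x} [AddCommGroup M] [Module R M]

/-- The operator averaged to the identity is `m ↦ sm`: `∑ t₍₁₎(s · χ(t₍₂₎)m) = ∑
(t₍₁₎s)(t₍₂₎χ(t₍₃₎)m) = (ts)m`. -/
theorem IsLeftRelativeHopfModule.isInjectiveComodule [Module S M] [IsScalarTower R S M]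
    {ρ : M →ₗ[R] M ⊗[R] HopfDual R A}
    (hρ : IsLeftRelativeHopfModule (inducedCoaction R A S) ρ) (hR : IsField R) {t : A}
    (ht : t ∈ leftIntegrals R A) {s : S} (hs : t • s = 1) :
    IsInjectiveComodule.{u, max u v, x, y} ρ := by
  refine isInjectiveComodule_of_average_eq_id hR hρ.isRightComodule
    (tmul_one_mul_of_left_integral ht) (leftAction R S M s) (LinearMap.ext fun m => ?_)
  let γ : A ⊗[R] A →ₗ[R] M := TensorProduct.lift ((leftAction R S M).compl₁₂
    (tensorDualEquiv R A S (inducedCoaction R A S s)) (tensorDualEquiv R A M (ρ m)))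
  have hγ : ∀ a b, γ (a ⊗ₜ b) = (a • s) • comoduleAction ρ b m := fun a b => by
    rw [← comoduleAction_inducedCoaction (R := R) (A := A) (M := S)]
    rfl
  have h1 : ∀ a b : A, average ρ ρ (leftAction R S M s) (a ⊗ₜ b) m =
      γ (comul a * ((1 : A) ⊗ₜ[R] b)) := by
    intro a b
    have h2 : ∀ z : A ⊗[R] A, TensorProduct.lift ((leftAction R S M).compl₁₂
        (tensorDualEquiv R A S (inducedCoaction R A S s))
        (tensorDualEquiv R A M (ρ (comoduleAction ρ b m)))) z =
          γ (z * ((1 : A) ⊗ₜ[R] b)) := by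
      intro z
      induction z with
      | zero => simp
      | add z z' hz hz' => simp only [map_add, add_mul, hz, hz']
      | tmul p q =>
        rw [Algebra.TensorProduct.tmul_mul_tmul, mul_one, hγ,
          comoduleAction_mul hρ.isRightComodule,
          ← comoduleAction_inducedCoaction (R := R) (A := A) (M := S)]
        rfl
    rw [average_tmul, comoduleAction_apply]
    change tensorDualEquiv R A M (ρ (s • _)) a = _
    rw [hρ.coaction_smul, tensorDualEquiv_map₂, h2]
  have h3 : average ρ ρ (leftAction R S M s) ((antipode R).lTensor A (comul t)) m =
      γ (∑ i ∈ (ℛ R t).index, (LinearMap.id : A →ₗ[R] A).lTensor A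
        (comul (R := R) ((ℛ R t).left i)) * ((1 : A) ⊗ₜ[R] antipode R ((ℛ R t).right i))) := by
    conv_lhs => rw [← (ℛ R t).eq]
    simp only [map_sum, LinearMap.sum_apply, LinearMap.lTensor_tmul, h1, LinearMap.lTensor_id,
      LinearMap.id_apply]
  rw [h3, sum_lTensor_comul_mul _ _ mul'_map_id_antipode, hγ, hs,
    comoduleAction_one hρ.isRightComodule, one_smul, LinearMap.id_apply]

/-- Here `s` multiplies on the right, so cancellation must occur in the first factors of `Δ`: with
`T = χ⁻¹`, `∑ t₍₂₎((T(t₍₁₎)m)s) = ∑ (t₍₂₎T(t₍₁₎)m)(t₍₃₎s) = m(ts)`. -/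
theorem IsRightRelativeHopfModule.isInjectiveComodule [Module Sᵐᵒᵖ M] [IsScalarTower R Sᵐᵒᵖ M]
    {ρ : M →ₗ[R] M ⊗[R] HopfDual R A}
    (hρ : IsRightRelativeHopfModule (inducedCoaction R A S) ρ) (hR : IsField R)
    (hA : Function.Bijective (antipode R : A →ₗ[R] A)) {t : A}
    (ht : t ∈ leftIntegrals R A) {s : S} (hs : t • s = 1) :
    IsInjectiveComodule.{u, max u v, x, y} ρ := by
  let e := LinearEquiv.ofBijective (antipode R : A →ₗ[R] A) hA
  let T : A →ₗ[R] A := e.symm.toLinearMap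
  have hT : ∀ a : A, antipode R (T a) = a := e.apply_symm_apply
  refine isInjectiveComodule_of_average_eq_id hR hρ.isRightComodule
    (tmul_one_mul_comm_of_left_integral hT hA.1 ht) ((rightAction R S M).flip s)
    (LinearMap.ext fun m => ?_)
  let γ : A ⊗[R] A →ₗ[R] M := TensorProduct.lift ((rightAction R S M).compl₁₂
    (tensorDualEquiv R A M (ρ m)) (tensorDualEquiv R A S (inducedCoaction R A S s)))
  have hγ : ∀ a b, γ (a ⊗ₜ b) = MulOpposite.op (b • s) • comoduleAction ρ a m := fun a b => by
    rw [← comoduleAction_inducedCoaction (R := R) (A := A) (M := S)]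
    rfl
  have h1 : ∀ a b : A, average ρ ρ ((rightAction R S M).flip s) (a ⊗ₜ b) m =
      γ (comul a * (b ⊗ₜ[R] (1 : A))) := by
    intro a b
    have h2 : ∀ z : A ⊗[R] A, TensorProduct.lift ((rightAction R S M).compl₁₂
        (tensorDualEquiv R A M (ρ (comoduleAction ρ b m)))
        (tensorDualEquiv R A S (inducedCoaction R A S s))) z =
          γ (z * (b ⊗ₜ[R] (1 : A))) := by
      intro z
      induction z with
      | zero => simp
      | add z z' hz hz' => simp only [map_add, add_mul, hz, hz']
      | tmul p q =>
        rw [Algebra.TensorProduct.tmul_mul_tmul, mul_one, hγ,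
          comoduleAction_mul hρ.isRightComodule,
          ← comoduleAction_inducedCoaction (R := R) (A := A) (M := S)]
        rfl
    rw [average_tmul, comoduleAction_apply]
    change tensorDualEquiv R A M (ρ (MulOpposite.op s • _)) a = _
    rw [hρ.coaction_smul, tensorDualEquiv_map₂, h2]
  have h3 : average ρ ρ ((rightAction R S M).flip s)
      (T.lTensor A (TensorProduct.comm R A A (comul t))) m =
      γ (∑ i ∈ (ℛ R t).index, (LinearMap.id : A →ₗ[R] A).rTensor A
        (comul (R := R) ((ℛ R t).right i)) * (T ((ℛ R t).left i) ⊗ₜ[R] (1 : A))) := by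
    conv_lhs => rw [← (ℛ R t).eq]
    simp only [map_sum, LinearMap.sum_apply, TensorProduct.comm_tmul, LinearMap.lTensor_tmul, h1,
      LinearMap.rTensor_id, LinearMap.id_apply]
  rw [h3, sum_rTensor_comul_mul _ _ (mul'_map_id_invAntipode_comm hT hA.1), hγ, hs,
    comoduleAction_one hρ.isRightComodule, MulOpposite.op_one, one_smul, LinearMap.id_apply]

end RelativeHopfModule

end TameHopf

theorem mainTheorem2 {R : Type u} [CommRing R] [IsLocalRing R]
    {A : Type v} [Ring A] [HopfAlgebra R A] [Module.Finite R A] [Module.Projective R A]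
    {S : Type w} [Ring S] [Algebra R S] [Module.Finite R S] [Module.Projective R S]
    [Module A S] [IsScalarTower R A S]
    (hS : TameHopf.IsModuleAlgebra R A S)
    (hfaithful : ∀ a : A, (∀ s : S, a • s = 0) → a = 0)
    (hrank : Module.finrank R S = Module.finrank R A)
    (hfixed : TameHopf.FixedPointsEqBase R A S) :
    (TameHopf.IsTameExtension R A S ↔
      ∃ g : TameHopf.HopfDual R A →ₗ[A] S, g 1 = 1) ∧
    (IsField R → TameHopf.IsTameExtension R A S →
      (∀ (M : Type x) [AddCommGroup M] [Module R M] [Module Sᵐᵒᵖ M] [IsScalarTower R Sᵐᵒᵖ M]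
        (ρ : M →ₗ[R] M ⊗[R] TameHopf.HopfDual R A),
        TameHopf.IsRightRelativeHopfModule (TameHopf.inducedCoaction R A S) ρ →
          TameHopf.IsInjectiveComodule.{u, max u v, x, y} ρ) ∧
      (∀ (M : Type x) [AddCommGroup M] [Module R M] [Module S M] [IsScalarTower R S M]
        (ρ : M →ₗ[R] M ⊗[R] TameHopf.HopfDual R A),
        TameHopf.IsLeftRelativeHopfModule (TameHopf.inducedCoaction R A S) ρ →
          TameHopf.IsInjectiveComodule.{u, max u v, x, y} ρ)) := by
  refine ⟨TameHopf.isTameExtension_iff_exists_hom hS hfaithful hrank hfixed, fun hR h => ?_⟩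
  obtain ⟨hA, θ, hθ⟩ := TameHopf.exists_frobenius_form (R := R) (A := A)
  obtain ⟨t, ht⟩ := hθ.2 1
  obtain ⟨s, hs⟩ := TameHopf.exists_smul_eq_one_of_integralImage hθ.1 ht h.integralImage_eq
  have hint := TameHopf.mem_leftIntegrals_of_smul_eq_one hθ.1 ht
  exact ⟨fun M _ _ _ _ ρ hρ => hρ.isInjectiveComodule hR hA hint hs,
    fun M _ _ _ _ ρ hρ => hρ.isInjectiveComodule hR hint hs⟩
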